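/- Let $L\ge 0$, let $\psi_A=(\psi_{A0},\dots,\psi_{AL})$ and $\psi_B=(\psi_{B0},\dots,\psi_{BL})$ be real vectors, put $\Psi_A(z)=\sum_{\ell=1}^L\psi_{A\ell}z^{-\ell}$, $\Psi_B(z)=\sum_{\ell=1}^L\psi_{B\ell}z^{-\ell}$, and factor over $\mathbb C$ $$1+\Psi_A(z)=\prod_{\ell=1}^L(1-a_\ell/z),\qquad 1+\Psi_B(z)=\prod_{\ell=1}^L(1-b_\ell/z).$$ Assume that $\psi_A$ is stable, i.e. $|a_\ell|<1$ for all $\ell$. Let $(\varepsilon^{(n)})$ be i.i.d. real random variables with mean $0$ and variance $\sigma_A^2$ (for instance Gaussian), and let $(x^{(n)})_{n\ge 0}$ be a wide-sense stationary real process with, almost surely for every $n\ge L$, $$x^{(n)}=-\psi_A^{T}\boldsymbol{x}^{(n)}+\varepsilon^{(n)},\qquad \boldsymbol{x}^{(n)}=[1,x^{(n-1)},\dots,x^{(n-L)}]^T .$$ Put $D(\psi_A,\psi_B)=E\{[x^{(n)}+\psi_B^T\boldsymbol{x}^{(n)}]^2\}-\sigma_A^2$. Then, for every $n\ge L$: (i)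 $E\{[x^{(n)}+\psi_A^T\boldsymbol{x}^{(n)}]^2\}=\sigma_A^2$ and $D(\psi_A,\psi_B)=E\{[(\psi_A-\psi_B)^T\boldsymbol{x}^{(n)}]^2\}$. (ii) With $$D_0(\psi_A,\psi_B)=\frac{\sigma_A^2}{2\pi}\int_{-\pi}^{\pi}\frac{|\Psi_A(e^{j\omega})-\Psi_B(e^{j\omega})|^2}{|1+\Psi_A(e^{j\omega})|^2}\,d\omega$$ one has $$D(\psi_A,\psi_B)=D_0(\psi_A,\psi_B)+\left(\psi_{B0}-\frac{1+\sum_{\ell=1}^L\psi_{B\ell}}{1+\sum_{\ell=1}^L\psi_{A\ell}}\,\psi_{A0}\right)^2 ;$$ in particular $D(\psi_A,\psi_B)=D_0(\psi_A,\psi_B)$ if $\psi_{A0}=\psi_{B0}=0$. (iii) If $a_1,\dots,a_L$ are nonzero and pairwise distinct, then $$D_0(\psi_A,\psi_B)=\sigma_A^2\sum_{k=1}^{L}\frac{\prod_{\ell=1}^{L}(a_k-b_\ell)}{a_k\prod_{\ell\ne k}(a_k-a_\ell)}\left(\frac{\prod_{\ell=1}^{L}(1-a_kb_\ell^*)}{\prod_{\ell=1}^{L}(1-a_ka_\ell^*)}-1\right),$$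 where $^*$ denotes the complex conjugate. (iv) Without the assumption of (iii), $D_0(\psi_A,\psi_B)$ is the limit of the right-hand side of (iii) with $(a_1,\dots,a_L)$ replaced by $(a_1',\dots,a_L')$, as $(a_1',\dots,a_L')\to(a_1,\dots,a_L)$ in $\mathbb C^L$ through tuples with nonzero, pairwise distinct entries. Likewise $D(\psi_A,\psi_B)$ is the limit of the sum of the right-hand side of (iii) at $a'$ and the squared correction term of (ii) at $\psi'$ (with $b$ and $\psi_B$ fixed), as $(\psi',a')\to(\psi_A,a)$ through real filters $\psi'$ with root tuples $a'$ whose entries are nonzero and pairwise distinct. -/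

import Mathlib

open MeasureTheory ProbabilityTheory Filter Topology

noncomputable section

namespace ARMismatch

/-- The vector `[1, x⁽ⁿ⁻¹⁾, …, x⁽ⁿ⁻ᴸ⁾]` of length `L + 1` at the sample point `ω`.
It is only used for `L ≤ n`, so that the subtraction of indices is genuine. -/
def regressor {Ω : Type*} (L : ℕ) (x : ℕ → Ω → ℝ) (n : ℕ) (ω : Ω) : Fin (L + 1) → ℝ :=
  Fin.cons 1 (fun ℓ : Fin L => x (n - (ℓ.val + 1)) ω)

/-- Wide-sense stationarity of a real process: finite second moments, constant mean,
shift-invariant covariances. -/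
structure IsWideSenseStationary {Ω : Type*} [MeasurableSpace Ω] (P : Measure Ω)
    (x : ℕ → Ω → ℝ) : Prop where
  memLp : ∀ n, MemLp (x n) 2 P
  mean : ∀ n, ∫ ω, x n ω ∂P = ∫ ω, x 0 ω ∂P
  cov : ∀ m n k, covariance (x (m + k)) (x (n + k)) P = covariance (x m) (x n) P

/-- Independent, identically distributed noise with mean zero and variance `σ ^ 2`. -/
structure IsIIDNoise {Ω : Type*} [MeasurableSpace Ω] (P : Measure Ω)
    (σ : ℝ) (ε : ℕ → Ω → ℝ) : Prop where
  indep : iIndepFun ε P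
  identDistrib : ∀ n, IdentDistrib (ε n) (ε 0) P P
  memLp : ∀ n, MemLp (ε n) 2 P
  mean : ∀ n, ∫ ω, ε n ω ∂P = 0
  variance : ∀ n, variance (ε n) P = σ ^ 2

/-- The data `x` obey `x⁽ⁿ⁾ = - ψᵀ [1, x⁽ⁿ⁻¹⁾, …, x⁽ⁿ⁻ᴸ⁾] + ε⁽ⁿ⁾` almost surely,
whenever the `L` preceding values exist. -/
def IsGeneratedBy {Ω : Type*} [MeasurableSpace Ω] (P : Measure Ω) {L : ℕ}
    (ψ : Fin (L + 1) → ℝ) (ε x : ℕ → Ω → ℝ) : Prop :=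
  ∀ n, L ≤ n → ∀ᵐ ω ∂P, x n ω = -(ψ ⬝ᵥ regressor L x n ω) + ε n ω

/-- Mean squared prediction error at time `n` when `- ψᵀ x⁽ⁿ⁾` is used as the prediction. -/
def mspe {Ω : Type*} [MeasurableSpace Ω] (P : Measure Ω) {L : ℕ}
    (ψ : Fin (L + 1) → ℝ) (x : ℕ → Ω → ℝ) (n : ℕ) : ℝ :=
  ∫ ω, (x n ω + ψ ⬝ᵥ regressor L x n ω) ^ 2 ∂P

/-- The mismatch distance `D(ψ_A, ψ_B)`: the excess, over the noise variance `σ ^ 2`, of the mean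
squared prediction error when the filter `ψB` is used for prediction. The generating filter `ψA`
enters through the law of `x`. -/
def mismatch {Ω : Type*} [MeasurableSpace Ω] (P : Measure Ω) {L : ℕ} (σ : ℝ)
    (ψB : Fin (L + 1) → ℝ) (x : ℕ → Ω → ℝ) (n : ℕ) : ℝ :=
  mspe P ψB x n - σ ^ 2

/-- The characteristic function `Ψ(z) = ∑_{ℓ=1}^{L} ψ_ℓ z^{-ℓ}`. -/
def charFn {L : ℕ} (ψ : Fin (L + 1) → ℝ) (z : ℂ) : ℂ :=
  ∑ ℓ : Fin L, (ψ ℓ.succ : ℂ) * z⁻¹ ^ (ℓ.val + 1)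

/-- `a₁, …, a_L` are the roots of `1 + Ψ`, with multiplicity:
`1 + Ψ(z) = ∏_{ℓ=1}^{L} (1 - a_ℓ / z)`. -/
def IsRootTuple {L : ℕ} (ψ : Fin (L + 1) → ℝ) (a : Fin L → ℂ) : Prop :=
  ∀ z : ℂ, z ≠ 0 → 1 + charFn ψ z = ∏ ℓ, (1 - a ℓ / z)

/-- The spectral integral
`D₀ = σ² / (2π) ∫_{-π}^{π} |Ψ_A(e^{jω}) - Ψ_B(e^{jω})|² / |1 + Ψ_A(e^{jω})|² dω`. -/
def spectralDist {L : ℕ} (σ : ℝ) (ψA ψB : Fin (L + 1) → ℝ) : ℝ :=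
  σ ^ 2 / (2 * Real.pi) *
    ∫ t in (-Real.pi)..Real.pi,
      ‖charFn ψA (Complex.exp (t * Complex.I)) - charFn ψB (Complex.exp (t * Complex.I))‖ ^ 2 /
        ‖1 + charFn ψA (Complex.exp (t * Complex.I))‖ ^ 2

/-- The finite sum over the roots. -/
def rootSum {L : ℕ} (σ : ℝ) (a b : Fin L → ℂ) : ℂ :=
  (σ : ℂ) ^ 2 * ∑ k : Fin L,
    (∏ ℓ, (a k - b ℓ)) / (a k * ∏ ℓ ∈ Finset.univ.erase k, (a k - a ℓ)) *
      ((∏ ℓ, (1 - a k * star (b ℓ))) / (∏ ℓ, (1 - a k * star (a ℓ))) - 1)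

/-- The correction term for nonzero means. -/
def meanCorrection {L : ℕ} (ψA ψB : Fin (L + 1) → ℝ) : ℝ :=
  (ψB 0 - (1 + ∑ ℓ : Fin L, ψB ℓ.succ) / (1 + ∑ ℓ : Fin L, ψA ℓ.succ) * ψA 0) ^ 2

/-- The roots are nonzero and pairwise distinct. -/
def Nondegenerate {L : ℕ} (a : Fin L → ℂ) : Prop :=
  (∀ k, a k ≠ 0) ∧ Function.Injective a

end ARMismatch

end

noncomputable section

namespace ARMismatch

/-! Write `A(S) = ∑ c_i S^i` for the prediction error filter, with `c = (1, ψ₁, …, ψ_L)`; it factors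
as `∏ (1 - a_ℓ S)`. Everything probabilistic rests on one fact: when all `|a_ℓ| < 1`, a bounded
sequence killed by `A(S)` is zero, whether `S` shifts forwards or backwards. The covariances of the
noise give the two-sided Yule-Walker equations `A(S) A(S⁻¹) γ = σ² δ₀` for the autocovariance `γ`,
which is bounded by stationarity. The hypotheses do not say that `ε⁽ⁿ⁾` is uncorrelated with earlier
values of `x`. This follows (`covariance_noise_past`): at positive lags the one-sided sequence `∑
c_i γ(k - i)` is bounded and killed by the forward filter, so it vanishes. Hence the cross term in
the prediction error drops out. The Fourier coefficients of `σ² / |1 + Ψ|²` are bounded and solve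
the same equations, so uniqueness identifies them with `γ` (`autocov_eq_spectralCov`). The variance
of `(ψ_A - ψ_B)ᵀ x⁽ⁿ⁾` is then `D₀`, and its squared mean is the correction term. For the closed
form, on the unit circle `D₀` integrates `|R - 1|²` with `R = ∏ (z - b_ℓ) / ∏ (z - a_ℓ)`. Partial
fractions expand `R - 1` into simple poles `a_k`, its conjugate continues analytically into the
disc, and Cauchy's formula evaluates each term (`rootSum_eq_integral`). The integral is continuous
in the roots, which gives the limits. -/

/-! ### Bounded solutions of stable linear recurrences. -/

/-- The linear operator `u ↦ u ∘ s` on complex functions. -/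
def compOperator {ι : Type*} (s : ι → ι) : Module.End ℂ (ι → ℂ) :=
  LinearMap.funLeft ℂ ℂ s

@[simp] lemma compOperator_apply {ι : Type*} (s : ι → ι) (u : ι → ℂ) (k : ι) :
    compOperator s u k = u (s k) := rfl

lemma compOperator_pow_apply {ι : Type*} (s : ι → ι) (n : ℕ) (u : ι → ℂ) (k : ι) :
    (compOperator s ^ n) u k = u (s^[n] k) := by
  induction n generalizing k with
  | zero => rfl
  | succ n ih => rw [pow_succ', Module.End.mul_apply, compOperator_apply, ih]; rfl

/-- Iterating the relation `n` times bounds `u` by `‖a‖ ^ n * M`, which tends to zero. -/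
lemma eq_zero_of_bounded_of_eq_mul_comp {ι : Type*} {s : ι → ι} {u : ι → ℂ} {M : ℝ}
    (hu : ∀ k, ‖u k‖ ≤ M) {a : ℂ} (ha : ‖a‖ < 1) (h : ∀ k, u k = a * u (s k)) : u = 0 := by
  have key : ∀ n k, ‖u k‖ ≤ ‖a‖ ^ n * M := by
    intro n
    induction n with
    | zero => simpa using hu
    | succ n ih =>
      intro k
      rw [h k, norm_mul, pow_succ', mul_assoc]
      exact mul_le_mul_of_nonneg_left (ih _) (norm_nonneg _)
  funext k
  have hlim : Tendsto (fun n : ℕ => ‖a‖ ^ n * M) atTop (𝓝 (0 * M)) :=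
    (tendsto_pow_atTop_nhds_zero_of_lt_one (norm_nonneg _) ha).mul_const M
  rw [zero_mul] at hlim
  exact norm_le_zero_iff.mp (ge_of_tendsto' hlim fun n => key n k)

lemma bounded_aeval_compOperator {ι : Type*} (s : ι → ι) (p : Polynomial ℂ) {u : ι → ℂ}
    (hu : ∃ M : ℝ, ∀ k, ‖u k‖ ≤ M) :
    ∃ M : ℝ, ∀ k, ‖Polynomial.aeval (compOperator s) p u k‖ ≤ M := by
  induction p using Polynomial.induction_on' with
  | add p q hp hq =>
    obtain ⟨M, hM⟩ := hp
    obtain ⟨N, hN⟩ := hq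
    refine ⟨M + N, fun k => ?_⟩
    rw [map_add, LinearMap.add_apply, Pi.add_apply]
    exact (norm_add_le _ _).trans (add_le_add (hM k) (hN k))
  | monomial n c =>
    obtain ⟨M, hM⟩ := hu
    refine ⟨‖c‖ * M, fun k => ?_⟩
    rw [Polynomial.aeval_monomial, Module.End.mul_apply, Module.algebraMap_end_apply,
      Pi.smul_apply, compOperator_pow_apply, norm_smul]
    exact mul_le_mul_of_nonneg_left (hM _) (norm_nonneg _)

/-- A bounded function annihilated by `∏ (1 - a_ℓ S)`, where `S u = u ∘ s` and all `a_ℓ` lie in the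
open unit disc, is zero. -/
lemma eq_zero_of_bounded_of_aeval_prod {ι κ : Type*} {s : ι → ι} (F : Finset κ) {a : κ → ℂ}
    (ha : ∀ ℓ, ‖a ℓ‖ < 1) {u : ι → ℂ} (hu : ∃ M : ℝ, ∀ k, ‖u k‖ ≤ M)
    (h : Polynomial.aeval (compOperator s)
      (∏ ℓ ∈ F, (1 - Polynomial.C (a ℓ) * Polynomial.X)) u = 0) : u = 0 := by
  classical
  induction F using Finset.induction_on with
  | empty => simpa using h
  | insert ℓ F hℓ ih =>
    apply ih
    -- The image of `u` under the remaining factors is still bounded and is killed by the single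
    -- factor `1 - a_ℓ S`, so it is zero.
    rw [Finset.prod_insert hℓ, map_mul, Module.End.mul_apply] at h
    obtain ⟨M, hM⟩ := bounded_aeval_compOperator s
      (∏ ℓ ∈ F, (1 - Polynomial.C (a ℓ) * Polynomial.X)) hu
    refine eq_zero_of_bounded_of_eq_mul_comp (s := s) hM (ha ℓ) fun k => ?_
    have hk := congrFun h k
    simp only [map_sub, map_one, map_mul, Polynomial.aeval_C, Polynomial.aeval_X,
      LinearMap.sub_apply, Module.End.one_apply, Module.End.mul_apply,
      Module.algebraMap_end_apply, Pi.sub_apply, Pi.smul_apply, compOperator_apply,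
      Pi.zero_apply, smul_eq_mul] at hk
    exact sub_eq_zero.mp hk

/-- The coefficients `1, ψ₁, …, ψ_L` of the prediction error filter. -/
def filterCoeff {L : ℕ} (ψ : Fin (L + 1) → ℝ) : Fin (L + 1) → ℝ :=
  Fin.cons 1 fun ℓ : Fin L => ψ ℓ.succ

lemma one_add_charFn {L : ℕ} (ψ : Fin (L + 1) → ℝ) (z : ℂ) :
    1 + charFn ψ z = ∑ i, (filterCoeff ψ i : ℂ) * z⁻¹ ^ (i : ℕ) := by
  simp [charFn, filterCoeff, Fin.sum_univ_succ]

/-- In the variable `w = 1/z` both sides are polynomials agreeing at every nonzero `w`. -/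
lemma IsRootTuple.sum_eq_prod {L : ℕ} {ψ : Fin (L + 1) → ℝ} {a : Fin L → ℂ}
    (ha : IsRootTuple ψ a) :
    ∑ i, Polynomial.C (filterCoeff ψ i : ℂ) * Polynomial.X ^ (i : ℕ) =
      ∏ ℓ, (1 - Polynomial.C (a ℓ) * Polynomial.X) := by
  refine Polynomial.eq_of_infinite_eval_eq _ _
    (Set.Infinite.mono ?_ (Set.finite_singleton (0 : ℂ)).infinite_compl)
  intro w hw
  have hw : w ≠ 0 := hw
  have := ha w⁻¹ (inv_ne_zero hw)
  rw [one_add_charFn] at this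
  simpa [Polynomial.eval_finsetSum, Polynomial.eval_prod, div_eq_mul_inv] using this

/-- A bounded solution of the linear recurrence with stable coefficients along `s` is zero. -/
lemma IsRootTuple.eq_zero_of_bounded {L : ℕ} {ψ : Fin (L + 1) → ℝ} {a : Fin L → ℂ}
    (ha : IsRootTuple ψ a) (hstable : ∀ ℓ, ‖a ℓ‖ < 1) {ι : Type*} (s : ι → ι) {u : ι → ℂ}
    (hu : ∃ M : ℝ, ∀ k, ‖u k‖ ≤ M)
    (h : ∀ k, ∑ i : Fin (L + 1), (filterCoeff ψ i : ℂ) * u (s^[i] k) = 0) : u = 0 := by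
  refine eq_zero_of_bounded_of_aeval_prod (s := s) Finset.univ hstable hu ?_
  rw [← ha.sum_eq_prod]
  funext k
  rw [map_sum, LinearMap.sum_apply, Finset.sum_apply, Pi.zero_apply, ← h k]
  refine Finset.sum_congr rfl fun i _ => ?_
  rw [map_mul, map_pow, Polynomial.aeval_C, Polynomial.aeval_X, Module.End.mul_apply,
    Module.algebraMap_end_apply, Pi.smul_apply, compOperator_pow_apply, smul_eq_mul]

lemma IsRootTuple.one_add_charFn_ne_zero {L : ℕ} {ψ : Fin (L + 1) → ℝ} {a : Fin L → ℂ}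
    (ha : IsRootTuple ψ a) (hstable : ∀ ℓ, ‖a ℓ‖ < 1) {z : ℂ} (hz : ‖z‖ = 1) :
    1 + charFn ψ z ≠ 0 := by
  have hz0 : z ≠ 0 := norm_ne_zero_iff.mp (by rw [hz]; exact one_ne_zero)
  rw [ha z hz0]
  refine Finset.prod_ne_zero_iff.mpr fun ℓ _ h => ?_
  have h1 : a ℓ = z := by
    rw [sub_eq_zero, eq_div_iff hz0, one_mul] at h
    exact h.symm
  exact (hstable ℓ).ne (by rw [h1, hz])

/-- This is the value of `1 + Ψ` at `z = 1`, a point of the unit circle. It makes the mean of the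
process, and so the correction term, well determined. -/
lemma IsRootTuple.one_add_sum_ne_zero {L : ℕ} {ψ : Fin (L + 1) → ℝ} {a : Fin L → ℂ}
    (ha : IsRootTuple ψ a) (hstable : ∀ ℓ, ‖a ℓ‖ < 1) : 1 + ∑ ℓ : Fin L, ψ ℓ.succ ≠ 0 := by
  have h := ha.one_add_charFn_ne_zero hstable (z := 1) (by simp)
  intro h0
  apply h
  have : ((1 + ∑ ℓ : Fin L, ψ ℓ.succ : ℝ) : ℂ) = 0 := by rw [h0]; simp
  simpa [charFn] using this

/-! ### Covariances of affine combinations. -/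

lemma covariance_congr_left {Ω : Type*} [MeasurableSpace Ω] {P : Measure Ω} {X X' Y : Ω → ℝ}
    (h : X =ᵐ[P] X') : covariance X Y P = covariance X' Y P := by
  unfold covariance
  rw [integral_congr_ae h]
  refine integral_congr_ae ?_
  filter_upwards [h] with ω hω
  rw [hω]

/-- Both `X + Y` and `X - Y` have nonnegative variance. -/
lemma two_mul_abs_covariance_le {Ω : Type*} [MeasurableSpace Ω] {P : Measure Ω}
    [IsProbabilityMeasure P] {X Y : Ω → ℝ} (hX : MemLp X 2 P) (hY : MemLp Y 2 P) :
    2 * |covariance X Y P| ≤ variance X P + variance Y P := by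
  have h1 := variance_add hX hY
  have h2 := variance_sub hX hY
  have h3 := variance_nonneg (X + Y) P
  have h4 := variance_nonneg (X - Y) P
  rcases abs_cases (covariance X Y P) with ⟨h, _⟩ | ⟨h, _⟩ <;> rw [h] <;> linarith

lemma memLp_sum_mul_add_const {Ω ι : Type*} [MeasurableSpace Ω] {P : Measure Ω}
    [IsProbabilityMeasure P] [Fintype ι] (p : ι → ℝ) (c : ℝ) {X : ι → Ω → ℝ}
    (hX : ∀ i, MemLp (X i) 2 P) : MemLp (fun ω => ∑ i, p i * X i ω + c) 2 P :=
  (memLp_finsetSum _ fun i _ => (hX i).const_mul (p i)).add (memLp_const c)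

lemma covariance_sum_mul_add_const_left {Ω ι : Type*} [MeasurableSpace Ω] {P : Measure Ω}
    [IsProbabilityMeasure P] [Fintype ι] (p : ι → ℝ) (c : ℝ) {X : ι → Ω → ℝ} {Y : Ω → ℝ}
    (hX : ∀ i, MemLp (X i) 2 P) (hY : MemLp Y 2 P) :
    covariance (fun ω => ∑ i, p i * X i ω + c) Y P = ∑ i, p i * covariance (X i) Y P := by
  have hi : ∀ i, MemLp (fun ω => p i * X i ω) 2 P := fun i => (hX i).const_mul (p i)
  rw [covariance_add_const_left ((memLp_finsetSum _ fun i _ => hi i).integrable one_le_two),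
    covariance_fun_sum_left hi hY]
  simp_rw [covariance_const_mul_left]

lemma covariance_sum_mul_add_const {Ω ι κ : Type*} [MeasurableSpace Ω] {P : Measure Ω}
    [IsProbabilityMeasure P] [Fintype ι] [Fintype κ] (p : ι → ℝ) (q : κ → ℝ) (c d : ℝ)
    {X : ι → Ω → ℝ} {Y : κ → Ω → ℝ}
    (hX : ∀ i, MemLp (X i) 2 P) (hY : ∀ j, MemLp (Y j) 2 P) :
    covariance (fun ω => ∑ i, p i * X i ω + c) (fun ω => ∑ j, q j * Y j ω + d) P =
      ∑ i, ∑ j, p i * q j * covariance (X i) (Y j) P := by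
  rw [covariance_sum_mul_add_const_left p c hX (memLp_sum_mul_add_const q d hY)]
  refine Finset.sum_congr rfl fun i _ => ?_
  rw [covariance_comm, covariance_sum_mul_add_const_left q d hY (hX i), Finset.mul_sum]
  refine Finset.sum_congr rfl fun j _ => ?_
  rw [covariance_comm, mul_assoc]

/-! ### Autocovariances and the Yule-Walker equations. -/

/-- The autocovariance sequence, indexed by all integers. -/
def autocov {Ω : Type*} [MeasurableSpace Ω] (P : Measure Ω) (x : ℕ → Ω → ℝ) (k : ℤ) : ℝ :=
  covariance (x k.toNat) (x (-k).toNat) P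

lemma IsWideSenseStationary.covariance_eq {Ω : Type*} [MeasurableSpace Ω] {P : Measure Ω}
    {x : ℕ → Ω → ℝ} (hx : IsWideSenseStationary P x) (m n : ℕ) :
    covariance (x m) (x n) P = autocov P x ((m : ℤ) - n) := by
  -- One of the two positive parts is zero; shifting both by `min m n` recovers `m` and `n`.
  have h := hx.cov ((m : ℤ) - n).toNat (-((m : ℤ) - n)).toNat (min m n)
  rw [autocov, ← h]
  congr 2 <;> omega

lemma IsWideSenseStationary.autocov_bounded {Ω : Type*} [MeasurableSpace Ω] {P : Measure Ω}
    [IsProbabilityMeasure P] {x : ℕ → Ω → ℝ} (hx : IsWideSenseStationary P x) (k : ℤ) :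
    ‖(autocov P x k : ℂ)‖ ≤ autocov P x 0 := by
  have hv : ∀ n, variance (x n) P = autocov P x 0 := fun n => by
    rw [← covariance_self (hx.memLp n).aestronglyMeasurable.aemeasurable, hx.covariance_eq, sub_self]
  have h := two_mul_abs_covariance_le (hx.memLp k.toNat) (hx.memLp (-k).toNat)
  rw [hv, hv] at h
  rw [Complex.norm_real, Real.norm_eq_abs, autocov]
  linarith

lemma add_dotProduct_regressor {Ω : Type*} {L : ℕ} (ψ : Fin (L + 1) → ℝ) (x : ℕ → Ω → ℝ) (n : ℕ)
    (ω : Ω) : x n ω + ψ ⬝ᵥ regressor L x n ω =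
      ∑ i : Fin (L + 1), filterCoeff ψ i * x (n - i) ω + ψ 0 := by
  simp [dotProduct, regressor, filterCoeff, Fin.sum_univ_succ]
  ring

lemma dotProduct_regressor {Ω : Type*} {L : ℕ} (ψ : Fin (L + 1) → ℝ) (x : ℕ → Ω → ℝ) (n : ℕ)
    (ω : Ω) : ψ ⬝ᵥ regressor L x n ω = ∑ ℓ : Fin L, ψ ℓ.succ * x (n - (ℓ + 1)) ω + ψ 0 := by
  simp [dotProduct, regressor, Fin.sum_univ_succ]
  ring

section Autocovariance

variable {Ω : Type*} [MeasurableSpace Ω] {P : Measure Ω}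
  {L : ℕ} {σ : ℝ} {ψ : Fin (L + 1) → ℝ} {ε x : ℕ → Ω → ℝ}

lemma IsGeneratedBy.noise_ae_eq (hgen : IsGeneratedBy P ψ ε x) {n : ℕ} (hn : L ≤ n) :
    ε n =ᵐ[P] fun ω => ∑ i : Fin (L + 1), filterCoeff ψ i * x (n - i) ω + ψ 0 := by
  filter_upwards [hgen n hn] with ω hω
  rw [← add_dotProduct_regressor, hω]
  ring

lemma IsIIDNoise.covariance_eq (hε : IsIIDNoise P σ ε) (m n : ℕ) :
    covariance (ε m) (ε n) P = if m = n then σ ^ 2 else 0 := by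
  split_ifs with h
  · rw [h, covariance_self (hε.memLp n).aestronglyMeasurable.aemeasurable, hε.variance]
  · exact (hε.indep.indepFun h).covariance_eq_zero (hε.memLp m) (hε.memLp n)

/-- Each noise variable is the filter applied to `x`, so the covariance of two of them is a
quadratic form in the autocovariances. -/
lemma autocov_yuleWalker [IsProbabilityMeasure P] (hε : IsIIDNoise P σ ε) (hx : IsWideSenseStationary P x)
    (hgen : IsGeneratedBy P ψ ε x) (k : ℤ) :
    ∑ i : Fin (L + 1), ∑ j : Fin (L + 1), filterCoeff ψ i * filterCoeff ψ j *
      autocov P x (k - (i : ℕ) + (j : ℕ)) = if k = 0 then σ ^ 2 else 0 := by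
  -- These times differ by `k`, and both are at least `L`, where the recurrence is available.
  have h := hε.covariance_eq (L + k.toNat) (L + (-k).toNat)
  rw [covariance_congr_left (hgen.noise_ae_eq (Nat.le_add_right _ _)), covariance_comm,
    covariance_congr_left (hgen.noise_ae_eq (Nat.le_add_right _ _)), covariance_comm,
    covariance_sum_mul_add_const _ _ _ _ (fun i => hx.memLp _) (fun i => hx.memLp _)] at h
  have hk : (L + k.toNat = L + (-k).toNat) ↔ k = 0 := by omega
  simp only [hk] at h
  rw [← h]
  refine Finset.sum_congr rfl fun i _ => Finset.sum_congr rfl fun j _ => ?_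
  rw [hx.covariance_eq]
  congr 2
  have := i.isLt
  have := j.isLt
  omega

end Autocovariance

/-! ### Uniqueness for the Yule-Walker equations. -/

section Recurrence

variable {L : ℕ} {ψ : Fin (L + 1) → ℝ} {a : Fin L → ℂ}

lemma bounded_filter {γ : ℤ → ℂ} (c : Fin (L + 1) → ℂ) (hγ : ∃ M : ℝ, ∀ k, ‖γ k‖ ≤ M)
    {ι : Type*} (e : ι → Fin (L + 1) → ℤ) : ∃ M : ℝ, ∀ k, ‖∑ i, c i * γ (e k i)‖ ≤ M := by
  obtain ⟨M, hM⟩ := hγ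
  refine ⟨∑ i, ‖c i‖ * M, fun k => (norm_sum_le _ _).trans (Finset.sum_le_sum fun i _ => ?_)⟩
  rw [norm_mul]
  exact mul_le_mul_of_nonneg_left (hM _) (norm_nonneg _)

lemma sub_one_iterate (n : ℕ) (k : ℤ) : (fun k : ℤ => k - 1)^[n] k = k - n := by
  induction n generalizing k with
  | zero => simp
  | succ n ih => rw [Function.iterate_succ_apply, ih]; push_cast; ring

lemma add_one_iterate (n : ℕ) (k : ℤ) : (fun k : ℤ => k + 1)^[n] k = k + n := by
  induction n generalizing k with
  | zero => simp
  | succ n ih => rw [Function.iterate_succ_apply, ih]; push_cast; ring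

/-- A bounded solution of the Yule-Walker equations is causal. -/
lemma IsRootTuple.filter_eq_zero (ha : IsRootTuple ψ a) (hstable : ∀ ℓ, ‖a ℓ‖ < 1) {γ : ℤ → ℂ}
    (hγ : ∃ M : ℝ, ∀ k, ‖γ k‖ ≤ M)
    (h : ∀ k : ℤ, 0 < k → ∑ i : Fin (L + 1), ∑ j : Fin (L + 1),
      (filterCoeff ψ i : ℂ) * filterCoeff ψ j * γ (k - (i : ℕ) + (j : ℕ)) = 0)
    {k : ℤ} (hk : 0 < k) : ∑ i : Fin (L + 1), (filterCoeff ψ i : ℂ) * γ (k - (i : ℕ)) = 0 := by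
  -- The forward shift preserves positive lags, so the equations at lags `k + 1` with `k : ℕ`
  -- suffice.
  have key := ha.eq_zero_of_bounded hstable Nat.succ
    (u := fun k : ℕ => ∑ i : Fin (L + 1), (filterCoeff ψ i : ℂ) * γ ((k : ℤ) + 1 - (i : ℕ)))
    (bounded_filter _ hγ _) (fun k => by
      rw [← h (k + 1) (by omega), Finset.sum_comm]
      refine Finset.sum_congr rfl fun j _ => ?_
      rw [Finset.mul_sum]
      refine Finset.sum_congr rfl fun i _ => ?_
      rw [Nat.succ_iterate, mul_left_comm, mul_assoc]
      congr 3
      push_cast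
      ring)
  have hk' := congrFun key (k - 1).toNat
  have h1 : (((k - 1).toNat : ℕ) : ℤ) + 1 = k := by omega
  simpa only [h1, Pi.zero_apply] using hk'

/-- Bounded two-sided solutions of the homogeneous Yule-Walker equations vanish. -/
lemma IsRootTuple.eq_zero_of_yuleWalker (ha : IsRootTuple ψ a) (hstable : ∀ ℓ, ‖a ℓ‖ < 1)
    {γ : ℤ → ℂ} (hγ : ∃ M : ℝ, ∀ k, ‖γ k‖ ≤ M)
    (h : ∀ k : ℤ, ∑ i : Fin (L + 1), ∑ j : Fin (L + 1),
      (filterCoeff ψ i : ℂ) * filterCoeff ψ j * γ (k - (i : ℕ) + (j : ℕ)) = 0) : γ = 0 := by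
  -- The two filters are removed one after the other: the backward one annihilates the
  -- forward-filtered `γ`, and then the forward one annihilates `γ`.
  refine ha.eq_zero_of_bounded hstable (fun k => k + 1) hγ fun k => ?_
  refine congrFun (ha.eq_zero_of_bounded hstable (fun k : ℤ => k - 1)
    (u := fun k => ∑ j : Fin (L + 1), (filterCoeff ψ j : ℂ) * γ ((fun k => k + 1)^[j] k))
    (bounded_filter _ hγ _) fun k => ?_) k
  rw [← h k]
  refine Finset.sum_congr rfl fun i _ => ?_
  rw [Finset.mul_sum]
  refine Finset.sum_congr rfl fun j _ => ?_
  rw [sub_one_iterate, add_one_iterate, mul_assoc]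

end Recurrence

/-! ### Orthogonality of the noise, and the mean correction. -/

section Orthogonality

variable {Ω : Type*} [MeasurableSpace Ω] {P : Measure Ω} [IsProbabilityMeasure P]
  {L : ℕ} {σ : ℝ} {ψ : Fin (L + 1) → ℝ} {a : Fin L → ℂ} {ε x : ℕ → Ω → ℝ}

lemma autocov_yuleWalker_complex (hε : IsIIDNoise P σ ε) (hx : IsWideSenseStationary P x)
    (hgen : IsGeneratedBy P ψ ε x) (k : ℤ) :
    ∑ i : Fin (L + 1), ∑ j : Fin (L + 1), (filterCoeff ψ i : ℂ) * filterCoeff ψ j *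
      autocov P x (k - (i : ℕ) + (j : ℕ)) = if k = 0 then (σ : ℂ) ^ 2 else 0 := by
  have h := congrArg (fun r : ℝ => (r : ℂ)) (autocov_yuleWalker hε hx hgen k)
  simpa only [Complex.ofReal_sum, Complex.ofReal_mul, apply_ite Complex.ofReal,
    Complex.ofReal_pow, Complex.ofReal_zero] using h

/-- The noise is uncorrelated with the past of the process. -/
lemma covariance_noise_past (ha : IsRootTuple ψ a) (hstable : ∀ ℓ, ‖a ℓ‖ < 1)
    (hε : IsIIDNoise P σ ε) (hx : IsWideSenseStationary P x)
    (hgen : IsGeneratedBy P ψ ε x) {n m : ℕ} (hn : L ≤ n) (hm : m < n) :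
    covariance (ε n) (x m) P = 0 := by
  rw [covariance_congr_left (hgen.noise_ae_eq hn),
    covariance_sum_mul_add_const_left _ _ (fun i => hx.memLp _) (hx.memLp m)]
  have h := ha.filter_eq_zero hstable (γ := fun k => (autocov P x k : ℂ))
    ⟨_, hx.autocov_bounded⟩
    (fun k hk => by rw [autocov_yuleWalker_complex hε hx hgen, if_neg hk.ne'])
    (k := (n : ℤ) - m) (by omega)
  rw [← Complex.ofReal_inj, Complex.ofReal_zero, ← h, Complex.ofReal_sum]
  refine Finset.sum_congr rfl fun i _ => ?_
  rw [hx.covariance_eq, Complex.ofReal_mul]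
  congr 3
  have := i.isLt
  omega

lemma memLp_dotProduct_regressor (hx : IsWideSenseStationary P x) (δ : Fin (L + 1) → ℝ) (n : ℕ) :
    MemLp (fun ω => δ ⬝ᵥ regressor L x n ω) 2 P := by
  simp_rw [dotProduct_regressor]
  exact memLp_sum_mul_add_const _ _ fun ℓ : Fin L => hx.memLp _

/-- As the noise is centred, this expectation is a covariance. The constant entry of the regressor
then drops out, and only past values remain. -/
lemma integral_noise_mul_dotProduct_regressor (ha : IsRootTuple ψ a) (hstable : ∀ ℓ, ‖a ℓ‖ < 1)
    (hε : IsIIDNoise P σ ε) (hx : IsWideSenseStationary P x)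
    (hgen : IsGeneratedBy P ψ ε x) {n : ℕ} (hn : L ≤ n) (δ : Fin (L + 1) → ℝ) :
    ∫ ω, ε n ω * (δ ⬝ᵥ regressor L x n ω) ∂P = 0 := by
  have h := covariance_eq_sub (hε.memLp n) (memLp_dotProduct_regressor hx δ n)
  rw [hε.mean, zero_mul, sub_zero] at h
  refine h.symm.trans ?_
  simp_rw [dotProduct_regressor]
  rw [covariance_comm, covariance_sum_mul_add_const_left _ _ (fun ℓ => hx.memLp _) (hε.memLp n)]
  refine Finset.sum_eq_zero fun ℓ _ => ?_
  rw [covariance_comm, covariance_noise_past ha hstable hε hx hgen hn, mul_zero]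
  have := ℓ.isLt
  omega

lemma mspe_self (hε : IsIIDNoise P σ ε) (hgen : IsGeneratedBy P ψ ε x) {n : ℕ} (hn : L ≤ n) :
    mspe P ψ x n = σ ^ 2 := by
  have hv := variance_eq_sub (hε.memLp n)
  rw [hε.variance, hε.mean, zero_pow two_ne_zero, sub_zero] at hv
  rw [mspe, hv]
  refine integral_congr_ae ?_
  filter_upwards [hgen n hn] with ω hω
  rw [Pi.pow_apply, hω]
  ring

/-- The prediction error of `ψB` is `ε n` minus `(ψ - ψB)ᵀ x⁽ⁿ⁾`, and the cross term of the square
vanishes by orthogonality. -/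
lemma mismatch_eq_integral (ha : IsRootTuple ψ a) (hstable : ∀ ℓ, ‖a ℓ‖ < 1)
    (hε : IsIIDNoise P σ ε) (hx : IsWideSenseStationary P x)
    (hgen : IsGeneratedBy P ψ ε x) {n : ℕ} (hn : L ≤ n) (ψB : Fin (L + 1) → ℝ) :
    mismatch P σ ψB x n = ∫ ω, ((ψ - ψB) ⬝ᵥ regressor L x n ω) ^ 2 ∂P := by
  have hR := memLp_dotProduct_regressor hx (ψ - ψB) n
  have hE := hε.memLp n
  have hv := variance_eq_sub hE
  rw [hε.variance, hε.mean, zero_pow two_ne_zero, sub_zero] at hv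
  have hmspe : mspe P ψB x n = ∫ ω, ((ε n ^ 2) ω - 2 * (ε n ω * ((ψ - ψB) ⬝ᵥ regressor L x n ω))
      + ((ψ - ψB) ⬝ᵥ regressor L x n ω) ^ 2) ∂P := by
    refine integral_congr_ae ?_
    filter_upwards [hgen n hn] with ω hω
    rw [Pi.pow_apply, hω, sub_dotProduct]
    ring
  have hi : Integrable (fun ω => 2 * (ε n ω * ((ψ - ψB) ⬝ᵥ regressor L x n ω))) P :=
    (hE.integrable_mul hR).const_mul 2
  have hsq : Integrable (fun ω => (ε n ^ 2) ω) P := hE.integrable_sq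
  have hd : Integrable
      (fun ω => (ε n ^ 2) ω - 2 * (ε n ω * ((ψ - ψB) ⬝ᵥ regressor L x n ω))) P := hsq.sub hi
  rw [mismatch, hmspe, integral_add hd hR.integrable_sq]
  have h2 : ∫ ω, ((ε n ^ 2) ω - 2 * (ε n ω * ((ψ - ψB) ⬝ᵥ regressor L x n ω))) ∂P = σ ^ 2 := by
    rw [integral_sub hsq hi, ← hv, integral_const_mul,
      integral_noise_mul_dotProduct_regressor ha hstable hε hx hgen hn, mul_zero, sub_zero]
  rw [h2]
  ring

lemma IsWideSenseStationary.mean_mul (hε : IsIIDNoise P σ ε) (hx : IsWideSenseStationary P x)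
    (hgen : IsGeneratedBy P ψ ε x) :
    (∫ ω, x 0 ω ∂P) * (1 + ∑ ℓ : Fin L, ψ ℓ.succ) = -ψ 0 := by
  have h := hε.mean L
  have hi : ∀ i : Fin (L + 1), Integrable (fun ω => filterCoeff ψ i * x (L - i) ω) P :=
    fun i => ((hx.memLp _).integrable one_le_two).const_mul _
  rw [integral_congr_ae (hgen.noise_ae_eq le_rfl),
    integral_add (integrable_finsetSum _ fun i _ => hi i) (integrable_const _),
    integral_finsetSum _ fun i _ => hi i] at h
  simp only [integral_const_mul, hx.mean (L - _), integral_const, probReal_univ, one_smul] at h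
  rw [← Finset.sum_mul, Fin.sum_univ_succ] at h
  simp only [filterCoeff, Fin.cons_zero, Fin.cons_succ] at h
  linarith

lemma integral_dotProduct_regressor (hx : IsWideSenseStationary P x) (δ : Fin (L + 1) → ℝ)
    (n : ℕ) : ∫ ω, δ ⬝ᵥ regressor L x n ω ∂P =
      (∑ ℓ : Fin L, δ ℓ.succ) * (∫ ω, x 0 ω ∂P) + δ 0 := by
  simp_rw [dotProduct_regressor]
  have hi : ∀ ℓ : Fin L, Integrable (fun ω => δ ℓ.succ * x (n - (ℓ + 1)) ω) P :=
    fun i => ((hx.memLp _).integrable one_le_two).const_mul _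
  rw [integral_add (integrable_finsetSum _ fun i _ => hi i) (integrable_const _),
    integral_finsetSum _ fun i _ => hi i]
  simp only [integral_const_mul, hx.mean (n - _), integral_const, probReal_univ, one_smul]
  rw [← Finset.sum_mul]

/-- The mean square of `(ψ - ψB)ᵀ x⁽ⁿ⁾` splits into a variance and the mean correction. -/
lemma integral_dotProduct_regressor_sq (ha : IsRootTuple ψ a) (hstable : ∀ ℓ, ‖a ℓ‖ < 1)
    (hε : IsIIDNoise P σ ε) (hx : IsWideSenseStationary P x)
    (hgen : IsGeneratedBy P ψ ε x) {n : ℕ} (hn : L ≤ n) (ψB : Fin (L + 1) → ℝ) :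
    ∫ ω, ((ψ - ψB) ⬝ᵥ regressor L x n ω) ^ 2 ∂P =
      ∑ i : Fin L, ∑ j : Fin L, (ψ - ψB) i.succ * (ψ - ψB) j.succ *
        autocov P x ((j : ℕ) - (i : ℕ)) + meanCorrection ψ ψB := by
  have hR := memLp_dotProduct_regressor hx (ψ - ψB) n
  have hv := variance_eq_sub hR
  have hmean : (∫ ω, (ψ - ψB) ⬝ᵥ regressor L x n ω ∂P) ^ 2 = meanCorrection ψ ψB := by
    rw [integral_dotProduct_regressor hx, meanCorrection]
    have h0 := ha.one_add_sum_ne_zero hstable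
    have hm := hx.mean_mul hε hgen
    -- Eliminating `ψ 0` through the mean `μ` turns the left side into `(μ (1 + ∑ ψB_ℓ) + ψB₀)²`.
    have hψ : ψ 0 = -((∫ ω, x 0 ω ∂P) * (1 + ∑ ℓ : Fin L, ψ ℓ.succ)) := by rw [hm, neg_neg]
    simp only [Pi.sub_apply, Finset.sum_sub_distrib]
    rw [hψ]
    field_simp
    ring
  have hvar : variance (fun ω => (ψ - ψB) ⬝ᵥ regressor L x n ω) P =
      ∑ i : Fin L, ∑ j : Fin L, (ψ - ψB) i.succ * (ψ - ψB) j.succ *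
        autocov P x ((j : ℕ) - (i : ℕ)) := by
    rw [← covariance_self hR.aestronglyMeasurable.aemeasurable]
    simp_rw [dotProduct_regressor]
    rw [covariance_sum_mul_add_const _ _ _ _ (fun i => hx.memLp _) (fun i => hx.memLp _)]
    refine Finset.sum_congr rfl fun i _ => Finset.sum_congr rfl fun j _ => ?_
    rw [hx.covariance_eq]
    congr 2
    have := i.isLt
    have := j.isLt
    omega
  rw [hmean, hvar] at hv
  have : ∫ ω, ((fun ω => (ψ - ψB) ⬝ᵥ regressor L x n ω) ^ 2) ω ∂P =
    ∫ ω, ((ψ - ψB) ⬝ᵥ regressor L x n ω) ^ 2 ∂P := rfl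
  rw [← this]
  linarith

end Orthogonality

/-! ### Fourier coefficients of the spectral density. -/

lemma exp_mul_I_ne_zero (t : ℝ) : Complex.exp (t * Complex.I) ≠ 0 := Complex.exp_ne_zero _

lemma continuous_exp_mul_I : Continuous fun t : ℝ => Complex.exp (t * Complex.I) := by fun_prop

lemma continuous_exp_mul_I_zpow (k : ℤ) :
    Continuous fun t : ℝ => Complex.exp (t * Complex.I) ^ k :=
  continuous_exp_mul_I.zpow₀ k fun t => Or.inl (exp_mul_I_ne_zero t)

lemma integral_exp_mul_I_zpow (k : ℤ) :
    ∫ t in (-Real.pi)..Real.pi, Complex.exp (t * Complex.I) ^ k =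
      if k = 0 then 2 * (Real.pi : ℂ) else 0 := by
  split_ifs with hk
  · subst hk
    simp only [zpow_zero, intervalIntegral.integral_const, Complex.real_smul, mul_one]
    push_cast
    ring
  · have hc : (k : ℂ) * Complex.I ≠ 0 :=
      mul_ne_zero (Int.cast_ne_zero.mpr hk) Complex.I_ne_zero
    have h : ∀ t : ℝ, Complex.exp (t * Complex.I) ^ k = Complex.exp ((k : ℂ) * Complex.I * t) := by
      intro t
      rw [← Complex.exp_int_mul]
      congr 1
      ring
    simp_rw [h]
    rw [integral_exp_mul_complex hc, div_eq_zero_iff]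
    left
    rw [sub_eq_zero, Complex.exp_eq_exp_iff_exists_int]
    exact ⟨k, by push_cast; ring⟩

lemma star_exp_mul_I (t : ℝ) :
    star (Complex.exp (t * Complex.I)) = (Complex.exp (t * Complex.I))⁻¹ := by
  rw [← Complex.exp_neg, Complex.star_def, ← Complex.exp_conj]
  simp

lemma star_sum_mul_inv_pow {ι : Type*} [Fintype ι] (p : ι → ℝ) (d : ι → ℕ) (t : ℝ) :
    star (∑ i, (p i : ℂ) * (Complex.exp (t * Complex.I))⁻¹ ^ d i) =
      ∑ i, (p i : ℂ) * Complex.exp (t * Complex.I) ^ d i := by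
  simp only [star_sum, star_mul', star_pow, ← star_exp_mul_I, star_star]
  simp

lemma ofReal_norm_sq (z : ℂ) : ((‖z‖ ^ 2 : ℝ) : ℂ) = z * star z := by
  rw [Complex.star_def, Complex.mul_conj, Complex.normSq_eq_norm_sq]

/-- The inverse Fourier transform of the spectral density `σ² / |1 + Ψ|²`. -/
def spectralCov {L : ℕ} (σ : ℝ) (ψ : Fin (L + 1) → ℝ) (k : ℤ) : ℂ :=
  (σ : ℂ) ^ 2 / (2 * Real.pi) * ∫ t in (-Real.pi)..Real.pi,
    Complex.exp (t * Complex.I) ^ k *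
      ((‖1 + charFn ψ (Complex.exp (t * Complex.I))‖ ^ 2)⁻¹ : ℝ)

section

variable {L : ℕ} {σ : ℝ} {ψ : Fin (L + 1) → ℝ} {a : Fin L → ℂ}

lemma continuous_charFn_exp (ψ : Fin (L + 1) → ℝ) :
    Continuous fun t : ℝ => charFn ψ (Complex.exp (t * Complex.I)) := by
  unfold charFn
  refine continuous_finsetSum _ fun ℓ _ => continuous_const.mul (Continuous.pow ?_ _)
  exact continuous_exp_mul_I.inv₀ exp_mul_I_ne_zero

lemma IsRootTuple.norm_ne_zero (ha : IsRootTuple ψ a) (hstable : ∀ ℓ, ‖a ℓ‖ < 1) (t : ℝ) :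
    ‖1 + charFn ψ (Complex.exp (t * Complex.I))‖ ^ 2 ≠ 0 :=
  pow_ne_zero _ (norm_ne_zero_iff.mpr
    (ha.one_add_charFn_ne_zero hstable (Complex.norm_exp_ofReal_mul_I t)))

lemma IsRootTuple.continuous_density (ha : IsRootTuple ψ a) (hstable : ∀ ℓ, ‖a ℓ‖ < 1) :
    Continuous fun t : ℝ =>
      (((‖1 + charFn ψ (Complex.exp (t * Complex.I))‖ ^ 2)⁻¹ : ℝ) : ℂ) :=
  Complex.continuous_ofReal.comp
    (((continuous_const.add (continuous_charFn_exp ψ)).norm.pow 2).inv₀ (ha.norm_ne_zero hstable))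

lemma spectralCov_bounded (σ : ℝ) (ψ : Fin (L + 1) → ℝ) :
    ∃ M : ℝ, ∀ k, ‖spectralCov σ ψ k‖ ≤ M := by
  refine ⟨‖(σ : ℂ) ^ 2 / (2 * Real.pi)‖ * ∫ t in (-Real.pi)..Real.pi,
    (‖1 + charFn ψ (Complex.exp (t * Complex.I))‖ ^ 2)⁻¹, fun k => ?_⟩
  rw [spectralCov, norm_mul]
  refine mul_le_mul_of_nonneg_left ?_ (norm_nonneg _)
  refine (intervalIntegral.norm_integral_le_integral_norm (by linarith [Real.pi_pos])).trans_eq ?_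
  refine intervalIntegral.integral_congr fun t _ => ?_
  simp only [norm_mul, norm_zpow, Complex.norm_exp_ofReal_mul_I, one_zpow, one_mul,
    Complex.norm_real]
  exact Real.norm_of_nonneg (by positivity)

/-- Filtering Fourier coefficients multiplies the density by the transfer functions. The delays `d`
are left general: `i` serves the Yule-Walker equations, `i + 1` the spectral distance. -/
lemma IsRootTuple.sum_spectralCov (ha : IsRootTuple ψ a) (hstable : ∀ ℓ, ‖a ℓ‖ < 1) (σ : ℝ)
    {ι : Type*} [Fintype ι] (p q : ι → ℝ) (d : ι → ℕ) (k : ℤ) :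
    ∑ i, ∑ j, (p i : ℂ) * q j * spectralCov σ ψ (k - d i + d j) =
      (σ : ℂ) ^ 2 / (2 * Real.pi) * ∫ t in (-Real.pi)..Real.pi,
        Complex.exp (t * Complex.I) ^ k *
          ((∑ i, (p i : ℂ) * (Complex.exp (t * Complex.I))⁻¹ ^ d i) *
            star (∑ j, (q j : ℂ) * (Complex.exp (t * Complex.I))⁻¹ ^ d j)) *
          ((‖1 + charFn ψ (Complex.exp (t * Complex.I))‖ ^ 2)⁻¹ : ℝ) := by
  have hc : ∀ m : ℤ, IntervalIntegrable (fun t : ℝ => Complex.exp (t * Complex.I) ^ m *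
      ((‖1 + charFn ψ (Complex.exp (t * Complex.I))‖ ^ 2)⁻¹ : ℝ)) volume (-Real.pi) Real.pi :=
    fun m => ((continuous_exp_mul_I_zpow m).mul
      (ha.continuous_density hstable)).intervalIntegrable _ _
  have hexp : ∀ t : ℝ, Complex.exp (t * Complex.I) ^ k *
          ((∑ i, (p i : ℂ) * (Complex.exp (t * Complex.I))⁻¹ ^ d i) *
            star (∑ j, (q j : ℂ) * (Complex.exp (t * Complex.I))⁻¹ ^ d j)) *
          ((‖1 + charFn ψ (Complex.exp (t * Complex.I))‖ ^ 2)⁻¹ : ℝ) =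
      ∑ i, ∑ j, (p i : ℂ) * q j * (Complex.exp (t * Complex.I) ^ (k - d i + d j) *
          ((‖1 + charFn ψ (Complex.exp (t * Complex.I))‖ ^ 2)⁻¹ : ℝ)) := by
    intro t
    rw [star_sum_mul_inv_pow, Finset.sum_mul_sum, Finset.mul_sum, Finset.sum_mul]
    refine Finset.sum_congr rfl fun i _ => ?_
    rw [Finset.mul_sum, Finset.sum_mul]
    refine Finset.sum_congr rfl fun j _ => ?_
    rw [zpow_add₀ (exp_mul_I_ne_zero t), zpow_sub₀ (exp_mul_I_ne_zero t), zpow_natCast,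
      zpow_natCast, inv_pow]
    ring
  have hi : ∀ i, IntervalIntegrable (fun t : ℝ => ∑ j, (p i : ℂ) * q j *
      (Complex.exp (t * Complex.I) ^ (k - d i + d j) *
        ((‖1 + charFn ψ (Complex.exp (t * Complex.I))‖ ^ 2)⁻¹ : ℝ))) volume
      (-Real.pi) Real.pi := fun i => by
    simpa only [Finset.sum_fn] using IntervalIntegrable.sum Finset.univ
      fun j _ => (hc (k - d i + d j)).const_mul ((p i : ℂ) * q j)
  simp_rw [hexp]
  rw [intervalIntegral.integral_finsetSum fun i _ => hi i, Finset.mul_sum]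
  refine Finset.sum_congr rfl fun i _ => ?_
  rw [intervalIntegral.integral_finsetSum fun j _ => (hc _).const_mul _, Finset.mul_sum]
  refine Finset.sum_congr rfl fun j _ => ?_
  rw [intervalIntegral.integral_const_mul, spectralCov]
  ring

/-- The two filters contribute `|1 + Ψ|²`, which cancels the density and leaves the integral of a
pure exponential. -/
lemma IsRootTuple.spectralCov_yuleWalker (ha : IsRootTuple ψ a) (hstable : ∀ ℓ, ‖a ℓ‖ < 1)
    (σ : ℝ) (k : ℤ) :
    ∑ i : Fin (L + 1), ∑ j : Fin (L + 1), (filterCoeff ψ i : ℂ) * filterCoeff ψ j *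
      spectralCov σ ψ (k - (i : ℕ) + (j : ℕ)) = if k = 0 then (σ : ℂ) ^ 2 else 0 := by
  rw [ha.sum_spectralCov hstable σ (filterCoeff ψ) (filterCoeff ψ) (fun i => (i : ℕ)) k]
  have h : ∀ t : ℝ, Complex.exp (t * Complex.I) ^ k *
          ((∑ i, (filterCoeff ψ i : ℂ) * (Complex.exp (t * Complex.I))⁻¹ ^ (i : ℕ)) *
            star (∑ j, (filterCoeff ψ j : ℂ) * (Complex.exp (t * Complex.I))⁻¹ ^ (j : ℕ))) *
          ((‖1 + charFn ψ (Complex.exp (t * Complex.I))‖ ^ 2)⁻¹ : ℝ) =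
      Complex.exp (t * Complex.I) ^ k := by
    intro t
    rw [← one_add_charFn, ← ofReal_norm_sq, mul_assoc, ← Complex.ofReal_mul,
      mul_inv_cancel₀ (ha.norm_ne_zero hstable t), Complex.ofReal_one, mul_one]
  simp_rw [h]
  rw [integral_exp_mul_I_zpow]
  have hpi : (Real.pi : ℂ) ≠ 0 := Complex.ofReal_ne_zero.mpr Real.pi_ne_zero
  split_ifs
  · field_simp
  · rw [mul_zero]

lemma IsRootTuple.ofReal_spectralDist (ha : IsRootTuple ψ a) (hstable : ∀ ℓ, ‖a ℓ‖ < 1)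
    (σ : ℝ) (ψB : Fin (L + 1) → ℝ) :
    (spectralDist σ ψ ψB : ℂ) = ∑ i : Fin L, ∑ j : Fin L,
      (((ψ - ψB) i.succ : ℝ) : ℂ) * ((ψ - ψB) j.succ : ℝ) *
        spectralCov σ ψ ((j : ℕ) - (i : ℕ)) := by
  have h := ha.sum_spectralCov hstable σ (fun i : Fin L => (ψ - ψB) i.succ)
    (fun i : Fin L => (ψ - ψB) i.succ) (fun i => (i : ℕ) + 1) 0
  have hidx : ∀ i j : Fin L, (0 : ℤ) - (((i : ℕ) + 1 : ℕ) : ℤ) + (((j : ℕ) + 1 : ℕ) : ℤ) =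
      (j : ℕ) - (i : ℕ) := by
    intro i j
    push_cast
    ring
  simp_rw [hidx] at h
  rw [h, spectralDist, Complex.ofReal_mul, ← intervalIntegral.integral_ofReal]
  push_cast
  congr 1
  refine intervalIntegral.integral_congr fun t _ => ?_
  have hδ : charFn ψ (Complex.exp (t * Complex.I)) - charFn ψB (Complex.exp (t * Complex.I)) =
      ∑ i : Fin L, (((ψ - ψB) i.succ : ℝ) : ℂ) *
        (Complex.exp (t * Complex.I))⁻¹ ^ ((i : ℕ) + 1) := by
    rw [charFn, charFn, ← Finset.sum_sub_distrib]
    refine Finset.sum_congr rfl fun i _ => ?_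
    rw [Pi.sub_apply]
    push_cast
    ring
  have hn := ofReal_norm_sq (charFn ψ (Complex.exp (t * Complex.I)) -
    charFn ψB (Complex.exp (t * Complex.I)))
  rw [hδ] at hn
  push_cast at hn
  simp only [zpow_zero, one_mul, hδ]
  rw [← hn, div_eq_mul_inv]

end

/-! ### Identification of the autocovariances with the spectral ones. -/

section

variable {Ω : Type*} [MeasurableSpace Ω] {P : Measure Ω} [IsProbabilityMeasure P]
  {L : ℕ} {σ : ℝ} {ψ : Fin (L + 1) → ℝ} {a : Fin L → ℂ} {ε x : ℕ → Ω → ℝ}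

/-- The autocovariances are the Fourier coefficients of the spectral density. -/
lemma autocov_eq_spectralCov (ha : IsRootTuple ψ a) (hstable : ∀ ℓ, ‖a ℓ‖ < 1)
    (hε : IsIIDNoise P σ ε) (hx : IsWideSenseStationary P x)
    (hgen : IsGeneratedBy P ψ ε x) (k : ℤ) : (autocov P x k : ℂ) = spectralCov σ ψ k := by
  obtain ⟨M, hM⟩ := spectralCov_bounded σ ψ
  have h := ha.eq_zero_of_yuleWalker hstable
    (γ := fun k => (autocov P x k : ℂ) - spectralCov σ ψ k)
    ⟨autocov P x 0 + M, fun k => (norm_sub_le _ _).trans (add_le_add (hx.autocov_bounded k) (hM k))⟩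
    (fun k => by
      simp_rw [mul_sub, Finset.sum_sub_distrib]
      rw [autocov_yuleWalker_complex hε hx hgen, ha.spectralCov_yuleWalker hstable, sub_self])
  exact sub_eq_zero.mp (congrFun h k)

lemma mismatch_eq_spectralDist_add (ha : IsRootTuple ψ a) (hstable : ∀ ℓ, ‖a ℓ‖ < 1)
    (hε : IsIIDNoise P σ ε) (hx : IsWideSenseStationary P x)
    (hgen : IsGeneratedBy P ψ ε x) {n : ℕ} (hn : L ≤ n) (ψB : Fin (L + 1) → ℝ) :
    mismatch P σ ψB x n = spectralDist σ ψ ψB + meanCorrection ψ ψB := by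
  rw [mismatch_eq_integral ha hstable hε hx hgen hn,
    integral_dotProduct_regressor_sq ha hstable hε hx hgen hn, add_left_inj,
    ← Complex.ofReal_inj, ha.ofReal_spectralDist hstable]
  push_cast
  simp_rw [autocov_eq_spectralCov ha hstable hε hx hgen]

end

/-! ### Closed form by partial fractions and Cauchy's formula. -/

/-- Partial fraction expansion of `∏ (z - b_ℓ) / ∏ (z - a_ℓ) - 1` for distinct `a_ℓ`. -/
lemma prod_sub_div_prod_sub_sub_one {L : ℕ} {a : Fin L → ℂ} (b : Fin L → ℂ)
    (ha : Function.Injective a) {z : ℂ} (hz : ∀ k, z ≠ a k) :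
    (∏ ℓ, (z - b ℓ)) / (∏ ℓ, (z - a ℓ)) - 1 =
      ∑ k, (∏ ℓ, (a k - b ℓ)) / (∏ ℓ ∈ Finset.univ.erase k, (a k - a ℓ)) * (z - a k)⁻¹ := by
  -- Both nodal polynomials are monic of degree `L`, so their difference has degree below `L` and
  -- equals its Lagrange interpolant at the `a_k`.
  set f : Polynomial ℂ := Lagrange.nodal Finset.univ b - Lagrange.nodal Finset.univ a with hf
  have hdeg : f.degree < (Finset.univ : Finset (Fin L)).card := by
    rw [← Lagrange.degree_nodal (s := Finset.univ) (v := b)]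
    refine Polynomial.degree_sub_lt_left ?_ Lagrange.nodal_ne_zero ?_
    · rw [Lagrange.degree_nodal, Lagrange.degree_nodal]
    · rw [Lagrange.nodal_monic.leadingCoeff, Lagrange.nodal_monic.leadingCoeff]
  have hne : ∏ ℓ, (z - a ℓ) ≠ 0 := Finset.prod_ne_zero_iff.mpr fun ℓ _ => sub_ne_zero.mpr (hz ℓ)
  have heval := congrArg (Polynomial.eval z) (Lagrange.eq_interpolate ha.injOn hdeg)
  rw [Lagrange.eval_interpolate_not_at_node _ fun i _ => hz i] at heval
  have hnode : ∀ k, Polynomial.eval (a k) f = ∏ ℓ, (a k - b ℓ) := fun k => by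
    rw [hf, Polynomial.eval_sub, Lagrange.eval_nodal_at_node (Finset.mem_univ k), sub_zero,
      Lagrange.eval_nodal]
  simp only [hnode] at heval
  rw [hf, Polynomial.eval_sub, Lagrange.eval_nodal, Lagrange.eval_nodal] at heval
  rw [div_sub_one hne, heval, mul_div_cancel_left₀ _ hne]
  refine Finset.sum_congr rfl fun k _ => ?_
  rw [Lagrange.nodalWeight, Finset.prod_inv_distrib]
  ring

/-- Both products equal `1` at `z = 0`. The extracted factor `z` is the one absorbed by `dz = i z
dt`. -/
lemma exists_prod_one_sub_mul_sub {ι : Type*} [Fintype ι] (a b : ι → ℂ) :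
    ∃ N : Polynomial ℂ, ∀ z : ℂ,
      ∏ ℓ, (1 - z * b ℓ) - ∏ ℓ, (1 - z * a ℓ) = z * N.eval z := by
  have h : Polynomial.X ∣ (∏ ℓ, (1 - Polynomial.X * Polynomial.C (b ℓ)) -
      ∏ ℓ, (1 - Polynomial.X * Polynomial.C (a ℓ)) : Polynomial ℂ) := by
    rw [Polynomial.X_dvd_iff, Polynomial.coeff_zero_eq_eval_zero]
    simp [Polynomial.eval_prod]
  obtain ⟨N, hN⟩ := h
  refine ⟨N, fun z => ?_⟩
  have := congrArg (Polynomial.eval z) hN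
  simpa only [Polynomial.eval_sub, Polynomial.eval_prod, Polynomial.eval_one, Polynomial.eval_mul,
    Polynomial.eval_X, Polynomial.eval_C] using this

lemma one_sub_mul_star_ne_zero {z a : ℂ} (hz : ‖z‖ ≤ 1) (ha : ‖a‖ < 1) : 1 - z * star a ≠ 0 := by
  intro h
  have h1 : z * star a = 1 := (sub_eq_zero.mp h).symm
  have h2 : ‖z‖ * ‖a‖ = 1 := by rw [← norm_star a, ← norm_mul, h1, norm_one]
  nlinarith [norm_nonneg z, norm_nonneg a]

/-- The squared modulus of `∏ (1 - b_ℓ / z) / ∏ (1 - a_ℓ / z) - 1` at `z = exp (i t)`. -/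
def ratioIntegrand {L : ℕ} (a b : Fin L → ℂ) (t : ℝ) : ℝ :=
  ‖(∏ ℓ, (1 - b ℓ / Complex.exp (t * Complex.I))) /
    (∏ ℓ, (1 - a ℓ / Complex.exp (t * Complex.I))) - 1‖ ^ 2

lemma intervalIntegral_exp_mul_I_eq_circleIntegral (f : ℂ → ℂ) :
    ∫ t in (-Real.pi)..Real.pi, Complex.exp (t * Complex.I) * f (Complex.exp (t * Complex.I)) =
      Complex.I⁻¹ * ∮ z in C(0, 1), f z := by
  have hper : Function.Periodic (fun t : ℝ =>
      Complex.exp (t * Complex.I) * f (Complex.exp (t * Complex.I))) (2 * Real.pi) := by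
    intro t
    have : Complex.exp ((t + 2 * Real.pi : ℝ) * Complex.I) = Complex.exp (t * Complex.I) := by
      push_cast
      rw [add_mul, Complex.exp_add, Complex.exp_two_pi_mul_I, mul_one]
    simp only [this]
  have h := hper.intervalIntegral_add_eq (-Real.pi) 0
  rw [zero_add, show -Real.pi + 2 * Real.pi = Real.pi by ring] at h
  rw [h, circleIntegral, ← intervalIntegral.integral_const_mul]
  refine intervalIntegral.integral_congr fun t _ => ?_
  simp only [deriv_circleMap, circleMap, Complex.ofReal_one, one_mul, zero_add, smul_eq_mul]
  field_simp

lemma rootSum_eq_integral {L : ℕ} (σ : ℝ) {a : Fin L → ℂ} (b : Fin L → ℂ)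
    (hstable : ∀ ℓ, ‖a ℓ‖ < 1) (ha : Nondegenerate a) :
    rootSum σ a b =
      ((σ ^ 2 / (2 * Real.pi) * ∫ t in (-Real.pi)..Real.pi, ratioIntegrand a b t : ℝ) : ℂ) := by
  obtain ⟨N, hN⟩ := exists_prod_one_sub_mul_sub (fun ℓ => star (a ℓ)) (fun ℓ => star (b ℓ))
  set c : Fin L → ℂ := fun k =>
    (∏ ℓ, (a k - b ℓ)) / ∏ ℓ ∈ Finset.univ.erase k, (a k - a ℓ) with hc
  -- On the circle the conjugate of `R - 1` is `z G(z)`, with `G` holomorphic on the closed disc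
  -- because the poles `1 / star (a ℓ)` lie outside it.
  set G : ℂ → ℂ := fun z => N.eval z / ∏ ℓ, (1 - z * star (a ℓ)) with hG
  have hden : ∀ z : ℂ, ‖z‖ ≤ 1 → ∏ ℓ, (1 - z * star (a ℓ)) ≠ 0 := fun z hz =>
    Finset.prod_ne_zero_iff.mpr fun ℓ _ => one_sub_mul_star_ne_zero hz (hstable ℓ)
  have hGz : ∀ z : ℂ, ‖z‖ ≤ 1 →
      (∏ ℓ, (1 - z * star (b ℓ))) / (∏ ℓ, (1 - z * star (a ℓ))) - 1 = z * G z := by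
    intro z hz
    rw [div_sub_one (hden z hz), hN z, hG, mul_div_assoc]
  have hGd : DifferentiableOn ℂ G (Metric.closedBall 0 1) := by
    refine N.differentiable.differentiableOn.div ?_ fun z hz => hden z (by simpa using hz)
    fun_prop
  have hcauchy : ∀ k, ∮ z in C(0, 1), (z - a k)⁻¹ • G z =
      (2 * (Real.pi : ℂ) * Complex.I) • G (a k) := fun k =>
    hGd.circleIntegral_sub_inv_smul (by simpa using hstable k)
  have hpt : ∀ t : ℝ, (ratioIntegrand a b t : ℂ) = Complex.exp (t * Complex.I) *
      (∑ k, c k * ((Complex.exp (t * Complex.I) - a k)⁻¹ • G (Complex.exp (t * Complex.I)))) := by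
    intro t
    set z := Complex.exp (t * Complex.I) with hz
    have hz0 : z ≠ 0 := exp_mul_I_ne_zero t
    have hz1 : ‖z‖ = 1 := Complex.norm_exp_ofReal_mul_I t
    have hza : ∀ k, z ≠ a k := fun k h => (hstable k).ne (by rw [← h, hz1])
    have hstar : star z = z⁻¹ := star_exp_mul_I t
    have hprod : ∀ d : Fin L → ℂ, star (∏ ℓ, (1 - d ℓ / z)) = ∏ ℓ, (1 - z * star (d ℓ)) := by
      intro d
      simp only [star_prod, star_sub, star_one, div_eq_mul_inv, star_mul', ← hstar, star_star]
      refine Finset.prod_congr rfl fun ℓ _ => ?_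
      ring
    have hshift : ∀ d : Fin L → ℂ, ∏ ℓ, (1 - d ℓ / z) = (∏ ℓ, (z - d ℓ)) / z ^ L := by
      intro d
      rw [← Fin.prod_const L z, ← Finset.prod_div_distrib]
      refine Finset.prod_congr rfl fun ℓ _ => ?_
      rw [sub_div, div_self hz0]
    have hratio : (∏ ℓ, (1 - b ℓ / z)) / (∏ ℓ, (1 - a ℓ / z)) - 1 =
        ∑ k, c k * (z - a k)⁻¹ := by
      rw [← prod_sub_div_prod_sub_sub_one b ha.2 hza, hshift, hshift,
        div_div_div_cancel_right₀ (pow_ne_zero L hz0)]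
    rw [ratioIntegrand, ofReal_norm_sq, star_sub, star_one, star_div₀, hprod, hprod,
      hGz z hz1.le, hratio, mul_left_comm, Finset.sum_mul]
    congr 1
    refine Finset.sum_congr rfl fun k _ => ?_
    rw [smul_eq_mul, mul_assoc]
  have hint : ∀ k, CircleIntegrable (fun z => c k * ((z - a k)⁻¹ • G z)) 0 1 := by
    intro k
    refine ContinuousOn.circleIntegrable zero_le_one ?_
    refine continuousOn_const.mul (ContinuousOn.smul (ContinuousOn.inv₀
      (continuousOn_id.sub continuousOn_const) ?_)
      (hGd.continuousOn.mono Metric.sphere_subset_closedBall))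
    intro z hz h
    rw [mem_sphere_zero_iff_norm] at hz
    have h' : z = a k := sub_eq_zero.mp h
    exact (hstable k).ne (by rw [← h', hz])
  rw [Complex.ofReal_mul, ← intervalIntegral.integral_ofReal]
  simp_rw [hpt]
  rw [intervalIntegral_exp_mul_I_eq_circleIntegral
      (fun z => ∑ k, c k * ((z - a k)⁻¹ • G z)),
    circleIntegral.integral_fun_sum fun k _ => hint k]
  simp_rw [circleIntegral.integral_const_mul, hcauchy]
  rw [rootSum, Finset.mul_sum, Finset.mul_sum, Finset.mul_sum]
  refine Finset.sum_congr rfl fun k _ => ?_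
  rw [hGz (a k) (hstable k).le, hc]
  have hpi : (Real.pi : ℂ) ≠ 0 := Complex.ofReal_ne_zero.mpr Real.pi_ne_zero
  -- Cauchy's formula yields `G (a k)`, whereas the closed form contains `a k * G (a k)` divided by
  -- `a k`; nonvanishing of the roots is needed only for this cancellation.
  have hak := ha.1 k
  have hI := Complex.I_ne_zero
  have hprod : ∏ ℓ ∈ Finset.univ.erase k, (a k - a ℓ) ≠ 0 :=
    Finset.prod_ne_zero_iff.mpr fun ℓ hℓ =>
      sub_ne_zero.mpr fun h => (Finset.mem_erase.mp hℓ).1 (ha.2 h).symm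
  push_cast
  simp only [smul_eq_mul]
  field_simp

lemma IsRootTuple.spectralDist_eq {L : ℕ} {ψA ψB : Fin (L + 1) → ℝ} {a b : Fin L → ℂ}
    (ha : IsRootTuple ψA a) (hb : IsRootTuple ψB b) (hstable : ∀ ℓ, ‖a ℓ‖ < 1) (σ : ℝ) :
    spectralDist σ ψA ψB =
      σ ^ 2 / (2 * Real.pi) * ∫ t in (-Real.pi)..Real.pi, ratioIntegrand a b t := by
  rw [spectralDist]
  congr 1
  refine intervalIntegral.integral_congr fun t _ => ?_
  have h0 := ha.one_add_charFn_ne_zero hstable (Complex.norm_exp_ofReal_mul_I t)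
  simp only [ratioIntegrand]
  rw [← ha _ (exp_mul_I_ne_zero t), ← hb _ (exp_mul_I_ne_zero t), div_sub_one h0, norm_div,
    div_pow, norm_sub_rev, add_sub_add_left_eq_sub]

/-! ### Limits at degenerate root tuples. -/

lemma tendsto_integral_ratioIntegrand {L : ℕ} {a : Fin L → ℂ} (b : Fin L → ℂ)
    (hstable : ∀ ℓ, ‖a ℓ‖ < 1) :
    Tendsto (fun a' => ∫ t in (-Real.pi)..Real.pi, ratioIntegrand a' b t) (𝓝 a)
      (𝓝 (∫ t in (-Real.pi)..Real.pi, ratioIntegrand a b t)) := by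
  -- On this open set the denominators never vanish on the circle, so the integrand is jointly
  -- continuous in the roots and `t`.
  let U : Set (Fin L → ℂ) := {a' | ∀ ℓ, ‖a' ℓ‖ < 1}
  have hU : IsOpen U := by
    simp only [U, Set.ofPred_forall]
    exact isOpen_iInter_of_finite fun ℓ =>
      isOpen_lt (continuous_apply ℓ).norm continuous_const
  have hcont : Continuous fun a' : U => ∫ t in (-Real.pi)..Real.pi, ratioIntegrand a' b t := by
    refine intervalIntegral.continuous_parametric_intervalIntegral_of_continuous' ?_ _ _
    have hexp : Continuous fun p : U × ℝ => Complex.exp (p.2 * Complex.I) := by fun_prop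
    have h0 : ∀ p : U × ℝ, Complex.exp (p.2 * Complex.I) ≠ 0 := fun p => exp_mul_I_ne_zero p.2
    refine Continuous.pow (Continuous.norm (Continuous.sub (Continuous.div ?_ ?_ ?_)
      continuous_const)) 2
    · exact continuous_finsetProd _ fun ℓ _ =>
        continuous_const.sub (continuous_const.div hexp h0)
    · refine continuous_finsetProd _ fun ℓ _ => continuous_const.sub (Continuous.div ?_ hexp h0)
      exact (continuous_apply ℓ).comp (continuous_subtype_val.comp continuous_fst)
    · intro p
      refine Finset.prod_ne_zero_iff.mpr fun ℓ _ h => (p.1.2 ℓ).ne ?_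
      rw [sub_eq_zero, eq_div_iff (h0 p), one_mul] at h
      rw [← h, Complex.norm_exp_ofReal_mul_I]
  exact (continuousOn_iff_continuous_domRestrict.mpr hcont).continuousAt (hU.mem_nhds hstable)

/-- Near `a` the roots stay in the disc, so the closed form equals the integral of `ratioIntegrand`.
That integral is written in the roots alone, so the approximating tuples need not come from real
filters. -/
lemma tendsto_rootSum {L : ℕ} {ψA ψB : Fin (L + 1) → ℝ} {a b : Fin L → ℂ}
    (ha : IsRootTuple ψA a) (hb : IsRootTuple ψB b) (hstable : ∀ ℓ, ‖a ℓ‖ < 1) (σ : ℝ) :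
    Tendsto (fun a' : Fin L → ℂ => rootSum σ a' b) (𝓝[{a' | Nondegenerate a'}] a)
      (𝓝 (spectralDist σ ψA ψB : ℂ)) := by
  rw [ha.spectralDist_eq hb hstable]
  have h : Tendsto (fun a' : Fin L → ℂ =>
      ((σ ^ 2 / (2 * Real.pi) * ∫ t in (-Real.pi)..Real.pi, ratioIntegrand a' b t : ℝ) : ℂ))
      (𝓝[{a' | Nondegenerate a'}] a) _ :=
    (Complex.continuous_ofReal.tendsto _).comp
      (((tendsto_integral_ratioIntegrand b hstable).const_mul _).mono_left nhdsWithin_le_nhds)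
  refine h.congr' ?_
  have hball : ∀ᶠ a' : Fin L → ℂ in 𝓝 a, ∀ ℓ, ‖a' ℓ‖ < 1 :=
    eventually_all.mpr fun ℓ =>
      ((continuous_apply ℓ).norm.tendsto a).eventually_lt_const (hstable ℓ)
  filter_upwards [self_mem_nhdsWithin, hball.filter_mono nhdsWithin_le_nhds] with a' h1 h2
  exact (rootSum_eq_integral σ b h2 h1).symm

lemma IsRootTuple.tendsto_meanCorrection {L : ℕ} {ψA : Fin (L + 1) → ℝ} {a : Fin L → ℂ}
    (ha : IsRootTuple ψA a) (hstable : ∀ ℓ, ‖a ℓ‖ < 1) (ψB : Fin (L + 1) → ℝ) :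
    Tendsto (fun ψ => meanCorrection ψ ψB) (𝓝 ψA) (𝓝 (meanCorrection ψA ψB)) := by
  have hsum : ContinuousAt (fun ψ : Fin (L + 1) → ℝ => 1 + ∑ ℓ : Fin L, ψ ℓ.succ) ψA :=
    (continuous_const.add
      (continuous_finsetSum _ fun ℓ _ => continuous_apply (Fin.succ ℓ))).continuousAt
  exact (continuousAt_const.sub ((continuousAt_const.div hsum
    (ha.one_add_sum_ne_zero hstable)).mul (continuous_apply 0).continuousAt)).pow 2

end ARMismatch

end

/-! ### The main theorem. -/

theorem mainTheorem4 {Ω : Type*} [MeasurableSpace Ω] (P : Measure Ω) [IsProbabilityMeasure P]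
    (L : ℕ) (σ : ℝ) (ψA ψB : Fin (L + 1) → ℝ) (a b : Fin L → ℂ)
    (ha : ARMismatch.IsRootTuple ψA a) (hb : ARMismatch.IsRootTuple ψB b)
    (hstable : ∀ ℓ, ‖a ℓ‖ < 1)
    (ε x : ℕ → Ω → ℝ)
    (hε : ARMismatch.IsIIDNoise P σ ε)
    (hx : ARMismatch.IsWideSenseStationary P x)
    (hgen : ARMismatch.IsGeneratedBy P ψA ε x) :
    -- the excess in prediction error is the mean square of `(ψ_A - ψ_B)ᵀ x⁽ⁿ⁾`
    (∀ n, L ≤ n →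
      ARMismatch.mspe P ψA x n = σ ^ 2 ∧
      ARMismatch.mismatch P σ ψB x n =
        ∫ ω, ((ψA - ψB) ⬝ᵥ ARMismatch.regressor L x n ω) ^ 2 ∂P) ∧
    -- zero-mean case: the spectral integral
    (ψA 0 = 0 → ψB 0 = 0 → ∀ n, L ≤ n →
      ARMismatch.mismatch P σ ψB x n = ARMismatch.spectralDist σ ψA ψB) ∧
    -- general case: the spectral integral plus the correction term
    (∀ n, L ≤ n → ARMismatch.mismatch P σ ψB x n =
      ARMismatch.spectralDist σ ψA ψB + ARMismatch.meanCorrection ψA ψB) ∧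
    -- closed form of the spectral integral for distinct nonzero roots
    (ARMismatch.Nondegenerate a →
      (ARMismatch.spectralDist σ ψA ψB : ℂ) = ARMismatch.rootSum σ a b) ∧
    -- degenerate cases: the value is the limit of the closed form, for `D₀` ...
    Tendsto (fun a' : Fin L → ℂ => ARMismatch.rootSum σ a' b)
      (𝓝[{a' | ARMismatch.Nondegenerate a'}] a)
      (𝓝 (ARMismatch.spectralDist σ ψA ψB : ℂ)) ∧
    -- ... and for `D`
    (∀ n, L ≤ n →
      Tendsto (fun p : (Fin (L + 1) → ℝ) × (Fin L → ℂ) =>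
          ARMismatch.rootSum σ p.2 b + (ARMismatch.meanCorrection p.1 ψB : ℂ))
        (𝓝[{p | ARMismatch.IsRootTuple p.1 p.2 ∧ ARMismatch.Nondegenerate p.2}] (ψA, a))
        (𝓝 (ARMismatch.mismatch P σ ψB x n : ℂ))) := by
  have hD : ∀ n, L ≤ n → ARMismatch.mismatch P σ ψB x n =
      ARMismatch.spectralDist σ ψA ψB + ARMismatch.meanCorrection ψA ψB := fun n hn =>
    ARMismatch.mismatch_eq_spectralDist_add ha hstable hε hx hgen hn ψB
  have hlim := ARMismatch.tendsto_rootSum ha hb hstable σ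
  refine ⟨fun n hn => ⟨ARMismatch.mspe_self hε hgen hn,
    ARMismatch.mismatch_eq_integral ha hstable hε hx hgen hn ψB⟩, ?_, hD, ?_, hlim, ?_⟩
  · intro hA hB n hn
    rw [hD n hn, ARMismatch.meanCorrection, hA, hB]
    ring
  · intro hnd
    rw [ha.spectralDist_eq hb hstable, ARMismatch.rootSum_eq_integral σ b hstable hnd]
  · intro n hn
    rw [hD n hn, Complex.ofReal_add]
    -- The root sum depends only on the root tuple and the correction only on the filter, so each
    -- limit is pulled back along a projection.
    refine Tendsto.add (hlim.comp ?_) ((Complex.continuous_ofReal.tendsto _).comp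
      ((ha.tendsto_meanCorrection hstable ψB).comp ?_))
    · refine tendsto_nhdsWithin_iff.mpr ⟨(continuous_snd.tendsto (ψA, a)).mono_left
        nhdsWithin_le_nhds, ?_⟩
      filter_upwards [self_mem_nhdsWithin] with p hp
      exact hp.2
    · exact (continuous_fst.tendsto (ψA, a)).mono_left nhdsWithin_le_nhds
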